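/- For $\tfrac12<p\le 1$ and $0\le\lambda\le 1$, a $(p,\lambda)$ environment is a map $\omega:\mathbb Z\to[0,1]$ such that $\omega(x)\in\{\tfrac12,p\}$ for every $x\in\mathbb Z$ and $$\limsup_{N\to\infty}\frac1{N+1}\sum_{x=0}^{N}\mathbf 1_{\{\omega(x)=p\}}=\lambda .$$ For $x\in\mathbb Z$, the random walk in $\omega$ started at $x$ is the Markov chain $(X_N)_{N\ge0}$ on $\mathbb Z$ with $X_0=x$ almost surely that jumps from $z$ to $z+1$ with probability $\omega(z)$ and from $z$ to $z-1$ with probability $1-\omega(z)$; its law is denoted $\mathbf P^x_\omega$. **Proposition.** For every integer $n>1$ there is a constant $D=D(n)>0$ such that the following holds for all integers $m\ge1$ and $0<l<n$. Put $\lambda=\dfrac{n}{mn+l}$ (so $\lambda$ is not of the form $1/k$ with $k\in\mathbb N$). Then for every $(1,\lambda)$ environment $\omega$ and every starting point $x\in\mathbb Z$, $$\limsup_{N\to\infty}\frac{X_N}{N}\le\lambda-D\lambda^3\qquad \mathbf P^x_\omega\text{-almost surely}.$$ -/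

import Mathlib

open MeasureTheory Filter

/-- `ω : ℤ → [0,1]` is a `(p, lam)` environment: every site is either fair or has drift `p`,
and the upper density of the drift sites on the non-negative half line equals `lam`.
(The averages lie in `[0,1]`, so the real `limsup` is the genuine one.) -/
structure IsEnvironment (p lam : ℝ) (ω : ℤ → unitInterval) : Prop where
  half_lt_p : 1 / 2 < p
  p_le_one : p ≤ 1
  lam_nonneg : 0 ≤ lam
  lam_le_one : lam ≤ 1
  value : ∀ x : ℤ, (ω x : ℝ) = 1 / 2 ∨ (ω x : ℝ) = p
  density : limsup (fun n : ℕ =>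
    (1 / ((n : ℝ) + 1)) *
      ∑ x ∈ Finset.range (n + 1),
        Set.indicator {y : ℤ | (ω y : ℝ) = p} (fun _ => (1 : ℝ)) (x : ℤ)) atTop = lam

/-- One-step transition probability from `z` to `y` in the environment `ω`. -/
noncomputable def transProb (ω : ℤ → unitInterval) (z y : ℤ) : ℝ :=
  if y = z + 1 then (ω z : ℝ) else if y = z - 1 then 1 - (ω z : ℝ) else 0

/-- `X` is, under `P`, the nearest neighbour random walk in the environment `ω` started at `x`:
the Markov chain on `ℤ` with initial law `δ_x` and transition probabilities `transProb ω`,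
expressed through its finite dimensional distributions. -/
structure IsRandomWalkIn {Ω : Type*} [MeasurableSpace Ω] (P : Measure Ω)
    (ω : ℤ → unitInterval) (x : ℤ) (X : ℕ → Ω → ℤ) : Prop where
  measurable : ∀ n : ℕ, Measurable (X n)
  path_prob : ∀ (n : ℕ) (a : ℕ → ℤ),
    P.real {w | ∀ i ≤ n, X i w = a i} =
      (if a 0 = x then 1 else 0) * ∏ i ∈ Finset.range n, transProb ω (a i) (a (i + 1))

/-! Build a function `potential` on the integers that rises along the walk by at most 1 per step on
average, yet grows steeply to the right. Its increment is 1 at a drift site, where the walk steps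
right surely; away from one it grows by 2 per site until capped at 2m + 1. At a fair site the mean
change is half the difference of neighbouring increments, hence at most 1. As increments are
bounded, a Chernoff bound and Borel–Cantelli show that the potential grows at rate at most 1
(`eventually_potential_lt`). Each drift site costs at most m(m + 1) against slope 2m + 1, so the
slope is asymptotically at least 2m + 1 - m(m + 1)λ (`exists_le_potential`), and the speed is at
most its inverse (`limsup_le`). For λ = 1/(m + θ) this falls below λ by order θ(1 - θ)λ³
(`one_div_speed_le`). -/

open scoped Topology ENNReal

/-! ### The potential and its slope. -/

section Potential

/-- The truncated proximity `max (m - u) 0` of `y` to the last point of `D` at or before `y`,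
where `u` is the distance of `y` to that point. -/
noncomputable def proximity (D : Set ℤ) (m : ℕ) (y : ℤ) : ℕ := by
  classical exact (Finset.range m).sup fun i => if y - i ∈ D then m - i else 0

lemma proximity_le (D : Set ℤ) (m : ℕ) (y : ℤ) : proximity D m y ≤ m := by
  classical
  unfold proximity
  refine Finset.sup_le fun i _ => ?_
  split_ifs <;> omega

lemma le_proximity {D : Set ℤ} {m : ℕ} {y : ℤ} {i : ℕ} (h : y - i ∈ D) :
    m - i ≤ proximity D m y := by
  classical
  rcases lt_or_ge i m with hi | hi
  · unfold proximity
    have := Finset.le_sup (f := fun i : ℕ => if y - i ∈ D then m - i else 0)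
      (Finset.mem_range.2 hi)
    simpa [h] using this
  · omega

lemma proximity_of_mem {D : Set ℤ} {y : ℤ} (m : ℕ) (h : y ∈ D) : proximity D m y = m :=
  le_antisymm (proximity_le D m y) (by simpa using le_proximity (m := m) (i := 0) (by simpa using h))

lemma proximity_of_notMem {D : Set ℤ} {y : ℤ} (m : ℕ) (h : y ∉ D) :
    proximity D m y = proximity D m (y - 1) - 1 := by
  classical
  apply le_antisymm
  · conv_lhs => unfold proximity
    refine Finset.sup_le fun i _ => ?_
    split_ifs with hi
    · cases i with
      | zero => simp [h] at hi
      | succ k =>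
        have : y - 1 - (k : ℤ) ∈ D := by
          convert hi using 1; push_cast; ring
        have := le_proximity (m := m) this
        omega
    · omega
  · suffices proximity D m (y - 1) ≤ proximity D m y + 1 by omega
    conv_lhs => unfold proximity
    refine Finset.sup_le fun i _ => ?_
    split_ifs with hi
    · have : y - ((i + 1 : ℕ) : ℤ) ∈ D := by
        convert hi using 1; push_cast; ring
      have := le_proximity (m := m) this
      omega
    · omega

/-- The discrete derivative of the potential. -/
noncomputable def increment (D : Set ℤ) (m : ℕ) (y : ℤ) : ℝ := 2 * m + 1 - 2 * proximity D m y

/-- The function on `ℤ` with increments `s` that vanishes at `0`. -/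
def discretePrimitive (s : ℤ → ℝ) : ℤ → ℝ
  | Int.ofNat k => ∑ i ∈ Finset.range k, s i
  | Int.negSucc k => -∑ i ∈ Finset.range (k + 1), s (Int.negSucc i)

lemma discretePrimitive_natCast (s : ℤ → ℝ) (k : ℕ) :
    discretePrimitive s k = ∑ i ∈ Finset.range k, s i := rfl

lemma discretePrimitive_add_one (s : ℤ → ℝ) (z : ℤ) :
    discretePrimitive s (z + 1) = discretePrimitive s z + s z := by
  cases z with
  | ofNat k =>
    change discretePrimitive s ((k : ℤ) + 1) = discretePrimitive s (k : ℤ) + s (k : ℤ)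
    rw [← Nat.cast_succ, discretePrimitive_natCast, discretePrimitive_natCast,
      Finset.sum_range_succ]
  | negSucc k =>
    cases k with
    | zero =>
      have h : Int.negSucc 0 + 1 = ((0 : ℕ) : ℤ) := rfl
      rw [h, discretePrimitive_natCast]
      simp [discretePrimitive]
    | succ k =>
      have h : Int.negSucc (k + 1) + 1 = Int.negSucc k := by omega
      rw [h]
      simp only [discretePrimitive]
      rw [Finset.sum_range_succ _ (k + 1)]
      ring

lemma one_le_increment (D : Set ℤ) (m : ℕ) (y : ℤ) : 1 ≤ increment D m y := by
  have : (proximity D m y : ℝ) ≤ m := by exact_mod_cast proximity_le D m y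
  unfold increment; linarith

lemma increment_le (D : Set ℤ) (m : ℕ) (y : ℤ) : increment D m y ≤ 2 * m + 1 := by
  unfold increment; linarith [(proximity D m y).cast_nonneg (α := ℝ)]

lemma increment_of_mem {D : Set ℤ} {y : ℤ} (m : ℕ) (h : y ∈ D) : increment D m y = 1 := by
  simp [increment, proximity_of_mem m h]

lemma increment_sub_le {D : Set ℤ} {y : ℤ} (m : ℕ) (h : y ∉ D) :
    increment D m y - increment D m (y - 1) ≤ 2 := by
  have : proximity D m (y - 1) ≤ proximity D m y + 1 := by
    rw [proximity_of_notMem m h]; omega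
  have : (proximity D m (y - 1) : ℝ) ≤ proximity D m y + 1 := by exact_mod_cast this
  unfold increment; linarith

/-- With q the last proximity, q(q - 1) is what the sum would still gain if no further point of `D`
occurred. It is conserved off `D` and renewed at cost at most m(m + 1) on `D`; the m² pays for
points left of 0. -/
lemma sum_proximity_le (D : Set ℤ) (m z : ℕ) :
    ∑ y ∈ Finset.range z, 2 * (proximity D m y : ℝ)
      + proximity D m ((z : ℤ) - 1) * (proximity D m ((z : ℤ) - 1) - 1)
    ≤ (m : ℝ) ^ 2 + m * (m + 1) *
      ∑ y ∈ Finset.range z, D.indicator (fun _ => (1 : ℝ)) (y : ℤ) := by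
  induction z with
  | zero =>
    have h1 : (proximity D m (-1) : ℝ) ≤ m := by exact_mod_cast proximity_le D m (-1)
    have h0 : (0 : ℝ) ≤ proximity D m (-1) := Nat.cast_nonneg _
    simp only [Finset.range_zero, Finset.sum_empty, Nat.cast_zero, zero_sub, zero_add, mul_zero,
      add_zero]
    nlinarith
  | succ z ih =>
    rw [Finset.sum_range_succ, Finset.sum_range_succ]
    have e : ((z + 1 : ℕ) : ℤ) - 1 = z := by push_cast; ring
    rw [e]
    by_cases h : (z : ℤ) ∈ D
    · have hq : (0 : ℝ) ≤ proximity D m ((z : ℤ) - 1) * (proximity D m ((z : ℤ) - 1) - 1) := by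
        rcases Nat.eq_zero_or_pos (proximity D m ((z : ℤ) - 1)) with h0 | h0
        · simp [h0]
        · have : (1 : ℝ) ≤ proximity D m ((z : ℤ) - 1) := by exact_mod_cast h0
          exact mul_nonneg (by linarith) (by linarith)
      rw [proximity_of_mem m h, Set.indicator_of_mem h]
      linarith
    · rw [Set.indicator_of_notMem h, proximity_of_notMem m h]
      rcases Nat.eq_zero_or_pos (proximity D m ((z : ℤ) - 1)) with h0 | h0
      · simp only [h0] at ih ⊢
        simpa using ih
      · rw [Nat.cast_sub h0]
        push_cast
        linarith

/-- The potential: its increments are `2 u + 1` at distance `u < m` after a point of `D`, and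
`2 m + 1` further away. -/
noncomputable def potential (D : Set ℤ) (m : ℕ) : ℤ → ℝ := discretePrimitive (increment D m)

lemma potential_add_one (D : Set ℤ) (m : ℕ) (z : ℤ) :
    potential D m (z + 1) = potential D m z + increment D m z := discretePrimitive_add_one _ _

lemma potential_sub_one (D : Set ℤ) (m : ℕ) (z : ℤ) :
    potential D m (z - 1) = potential D m z - increment D m (z - 1) := by
  have := potential_add_one D m (z - 1)
  rw [sub_add_cancel] at this
  linarith

lemma le_potential (D : Set ℤ) (m z : ℕ) :
    (2 * m + 1) * (z : ℝ) - m ^ 2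
      - m * (m + 1) * ∑ y ∈ Finset.range z, D.indicator (fun _ => (1 : ℝ)) (y : ℤ)
    ≤ potential D m z := by
  have h := sum_proximity_le D m z
  have hq : (0 : ℝ) ≤ proximity D m ((z : ℤ) - 1) * (proximity D m ((z : ℤ) - 1) - 1) := by
    rcases Nat.eq_zero_or_pos (proximity D m ((z : ℤ) - 1)) with h0 | h0
    · simp [h0]
    · have : (1 : ℝ) ≤ proximity D m ((z : ℤ) - 1) := by exact_mod_cast h0
      exact mul_nonneg (by linarith) (by linarith)
  have e : potential D m z
      = (2 * m + 1) * (z : ℝ) - ∑ y ∈ Finset.range z, 2 * (proximity D m y : ℝ) := by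
    rw [potential, discretePrimitive_natCast]
    simp only [increment]
    rw [Finset.sum_sub_distrib]
    simp only [Finset.sum_const, Finset.card_range, nsmul_eq_mul]
    ring
  rw [e]
  linarith

/-- Hoeffding's bound for a fair two-point jump: factor out the mean (a - b)/2, leaving a cosh. -/
lemma average_exp_le {a b S t : ℝ} (ht : 0 ≤ t) (ha : 0 ≤ a) (hb : 0 ≤ b) (haS : a ≤ S)
    (hbS : b ≤ S) (hab : a - b ≤ 2) :
    1 / 2 * Real.exp (t * a) + 1 / 2 * Real.exp (-(t * b))
      ≤ Real.exp (t + t ^ 2 * S ^ 2 / 2) := by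
  have e : 1 / 2 * Real.exp (t * a) + 1 / 2 * Real.exp (-(t * b))
      = Real.exp (t * ((a - b) / 2)) * Real.cosh (t * ((a + b) / 2)) := by
    rw [Real.cosh_eq, mul_div_assoc', mul_add, ← Real.exp_add, ← Real.exp_add]
    ring_nf
  rw [e, Real.exp_add]
  refine mul_le_mul (Real.exp_le_exp.2 ?_) ((Real.cosh_le_exp_half_sq _).trans
    (Real.exp_le_exp.2 ?_)) (Real.cosh_pos _).le (Real.exp_pos _).le
  · nlinarith
  · rw [mul_pow]
    have : ((a + b) / 2) ^ 2 ≤ S ^ 2 := pow_le_pow_left₀ (by linarith) (by linarith) 2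
    nlinarith [sq_nonneg t]

end Potential

/-! ### Markov property and exponential moments of the walk. -/

section Walk

variable {Ω : Type*} [MeasurableSpace Ω] {P : Measure Ω} {ω : ℤ → unitInterval} {x : ℤ}
  {X : ℕ → Ω → ℤ}

lemma transProb_nonneg (ω : ℤ → unitInterval) (z y : ℤ) : 0 ≤ transProb ω z y := by
  unfold transProb
  split_ifs
  · exact (ω z).2.1
  · linarith [(ω z).2.2]
  · exact le_rfl

lemma IsRandomWalkIn.measure_path [IsProbabilityMeasure P] (hX : IsRandomWalkIn P ω x X) (n : ℕ)
    (a : ℕ → ℤ) :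
    P {w | ∀ i ≤ n + 1, X i w = a i}
      = P {w | ∀ i ≤ n, X i w = a i} * ENNReal.ofReal (transProb ω (a n) (a (n + 1))) := by
  rw [← ofReal_measureReal, ← ofReal_measureReal, hX.path_prob, hX.path_prob,
    ← ENNReal.ofReal_mul, Finset.prod_range_succ, mul_assoc]
  exact mul_nonneg (by split_ifs <;> simp)
    (Finset.prod_nonneg fun i _ => transProb_nonneg ω _ _)

lemma IsRandomWalkIn.measure_zero [IsProbabilityMeasure P] (hX : IsRandomWalkIn P ω x X) :
    P {w | X 0 w = x} = 1 := by
  have h := hX.path_prob 0 (fun _ => x)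
  simp only [Nat.le_zero, forall_eq, if_true, Finset.range_zero, Finset.prod_empty, mul_one] at h
  rw [← ofReal_measureReal, h, ENNReal.ofReal_one]

lemma measure_eq_tsum_inter {β : Type*} [Countable β] [MeasurableSpace β]
    [MeasurableSingletonClass β] {Y : Ω → β} (hY : Measurable Y) (s : Set Ω) :
    P s = ∑' b, P (s ∩ {w | Y w = b}) := by
  have h := tsum_measure_preimage_singleton (μ := P.restrict s) (s := Set.univ) (f := Y)
    Set.countable_univ (fun b _ => hY (measurableSet_singleton b))
  rw [Set.preimage_univ, Measure.restrict_apply_univ] at h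
  rw [← h, tsum_univ (f := fun b => P.restrict s (Y ⁻¹' {b}))]
  refine tsum_congr fun b => ?_
  rw [Measure.restrict_apply (hY (measurableSet_singleton b)), Set.inter_comm]
  rfl

/-- The history of the walk up to time `n`. -/
def history (X : ℕ → Ω → ℤ) (n : ℕ) (w : Ω) : Fin (n + 1) → ℤ := fun i => X i w

lemma IsRandomWalkIn.measurable_history (hX : IsRandomWalkIn P ω x X) (n : ℕ) :
    Measurable (history X n) :=
  measurable_pi_lambda _ fun i => hX.measurable i

lemma IsRandomWalkIn.measure_step [IsProbabilityMeasure P] (hX : IsRandomWalkIn P ω x X) (n : ℕ)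
    (y z : ℤ) :
    P ({w | X (n + 1) w = z} ∩ {w | X n w = y})
      = P {w | X n w = y} * ENNReal.ofReal (transProb ω y z) := by
  rw [measure_eq_tsum_inter (P := P) (hX.measurable_history n) ({w | X (n + 1) w = z} ∩ _),
    measure_eq_tsum_inter (P := P) (hX.measurable_history n) {w | X n w = y},
    ← ENNReal.tsum_mul_right]
  refine tsum_congr fun b => ?_
  by_cases hb : b (Fin.last n) = y
  -- The default value makes `a` the history `b` followed by a step to `z`.
  · let a : ℕ → ℤ := fun i => if h : i < n + 1 then b ⟨i, h⟩ else z
    have han : a n = y := by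
      simp only [a, dif_pos (Nat.lt_succ_self n)]
      exact hb
    have haz : a (n + 1) = z := by simp [a]
    have hist : ∀ w, history X n w = b ↔ ∀ i ≤ n, X i w = a i := by
      intro w
      constructor
      · rintro rfl i hi
        simp only [a, dif_pos (Nat.lt_succ_of_le hi), history]
      · intro h
        funext i
        have := h i (Nat.le_of_lt_succ i.2)
        rwa [show a i = b i from dif_pos i.2] at this
    have h := hX.measure_path n a
    rw [han, haz] at h
    convert h using 2
    · ext w
      simp only [Set.mem_inter_iff, Set.mem_ofPred_eq, hist]
      constructor
      · rintro ⟨⟨h1, h2⟩, h3⟩ i hi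
        rcases Nat.le_succ_iff.1 hi with hi | rfl
        · exact h3 i hi
        · exact h1.trans haz.symm
      · intro h
        exact ⟨⟨(h _ le_rfl).trans haz, (h n (Nat.le_succ n)).trans han⟩,
          fun i hi => h i (hi.trans (Nat.le_succ n))⟩
    · congr 1
      ext w
      simp only [Set.mem_inter_iff, Set.mem_ofPred_eq, hist]
      exact ⟨fun h => h.2, fun h => ⟨(h n le_rfl).trans han, h⟩⟩
  · have hemp : {w | X n w = y} ∩ {w | history X n w = b} = ∅ := by
      ext w
      simp only [Set.mem_inter_iff, Set.mem_ofPred_eq, Set.mem_empty_iff_false, iff_false]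
      rintro ⟨h1, rfl⟩
      exact hb (by simpa [history] using h1)
    rw [Set.inter_assoc, hemp]
    simp

lemma IsRandomWalkIn.lintegral_eq_tsum (hX : IsRandomWalkIn P ω x X) (n : ℕ) (h : ℤ → ℝ≥0∞) :
    ∫⁻ w, h (X n w) ∂P = ∑' y, h y * P {w | X n w = y} := by
  rw [← lintegral_map (μ := P) (f := h) (Measurable.of_discrete) (hX.measurable n),
    lintegral_countable']
  refine tsum_congr fun y => ?_
  rw [Measure.map_apply (hX.measurable n) (measurableSet_singleton y)]
  rfl

lemma IsRandomWalkIn.lintegral_succ_le [IsProbabilityMeasure P] (hX : IsRandomWalkIn P ω x X)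
    (n : ℕ) {h : ℤ → ℝ} (h0 : ∀ z, 0 ≤ h z) {c : ℝ} (hc : 0 ≤ c)
    (hstep : ∀ y, ω y * h (y + 1) + (1 - ω y) * h (y - 1) ≤ c * h y) :
    ∫⁻ w, ENNReal.ofReal (h (X (n + 1) w)) ∂P
      ≤ ENNReal.ofReal c * ∫⁻ w, ENNReal.ofReal (h (X n w)) ∂P := by
  rw [hX.lintegral_eq_tsum (n + 1) (fun z => ENNReal.ofReal (h z)),
    hX.lintegral_eq_tsum n (fun z => ENNReal.ofReal (h z)), ← ENNReal.tsum_mul_left]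
  calc ∑' z, ENNReal.ofReal (h z) * P {w | X (n + 1) w = z}
      = ∑' z, ∑' y, ENNReal.ofReal (h z) *
          (P {w | X n w = y} * ENNReal.ofReal (transProb ω y z)) := by
        refine tsum_congr fun z => ?_
        rw [measure_eq_tsum_inter (P := P) (hX.measurable n) {w | X (n + 1) w = z},
          ← ENNReal.tsum_mul_left]
        exact tsum_congr fun y => by rw [hX.measure_step]
    _ = ∑' y, ∑' z, ENNReal.ofReal (h z) *
          (P {w | X n w = y} * ENNReal.ofReal (transProb ω y z)) := ENNReal.tsum_comm
    _ ≤ _ := by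
        refine ENNReal.tsum_le_tsum fun y => ?_
        have hne : y + 1 ≠ y - 1 := by omega
        rw [tsum_eq_sum (s := {y + 1, y - 1}), Finset.sum_pair hne]
        · have e1 : transProb ω y (y + 1) = ω y := by simp [transProb]
          have e2 : transProb ω y (y - 1) = 1 - ω y := by
            simp [transProb, hne.symm]
          have hp : (0 : ℝ) ≤ ω y := (ω y).2.1
          have hq : (0 : ℝ) ≤ 1 - ω y := by linarith [(ω y).2.2]
          rw [e1, e2]
          calc _ = (ENNReal.ofReal (ω y) * ENNReal.ofReal (h (y + 1))
                + ENNReal.ofReal (1 - ω y) * ENNReal.ofReal (h (y - 1)))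
                * P {w | X n w = y} := by ring
            _ = ENNReal.ofReal (ω y * h (y + 1) + (1 - ω y) * h (y - 1))
                * P {w | X n w = y} := by
              rw [ENNReal.ofReal_add (mul_nonneg hp (h0 _)) (mul_nonneg hq (h0 _)),
                ENNReal.ofReal_mul hp, ENNReal.ofReal_mul hq]
            _ ≤ ENNReal.ofReal (c * h y) * P {w | X n w = y} := by
              gcongr
              exact hstep y
            _ = _ := by rw [ENNReal.ofReal_mul hc, mul_assoc]
        · intro z hz
          simp only [Finset.mem_insert, Finset.mem_singleton, not_or] at hz
          simp [transProb, hz.1, hz.2]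

/-- The exponential moments of a function of the walk that grows at a bounded rate. -/
lemma IsRandomWalkIn.lintegral_le [IsProbabilityMeasure P] (hX : IsRandomWalkIn P ω x X)
    {h : ℤ → ℝ} (h0 : ∀ z, 0 ≤ h z) {c : ℝ} (hc : 0 ≤ c)
    (hstep : ∀ y, ω y * h (y + 1) + (1 - ω y) * h (y - 1) ≤ c * h y) (n : ℕ) :
    ∫⁻ w, ENNReal.ofReal (h (X n w)) ∂P ≤ ENNReal.ofReal (c ^ n * h x) := by
  induction n with
  | zero =>
    have : ∀ᵐ w ∂P, X 0 w = x :=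
      (prob_compl_eq_zero_iff (hX.measurable 0 (measurableSet_singleton x))).2 hX.measure_zero
    rw [lintegral_congr_ae (g := fun _ => ENNReal.ofReal (h x))
      (this.mono fun w hw => by simp only [hw])]
    simp
  | succ n ih =>
    refine (hX.lintegral_succ_le n h0 hc hstep).trans ?_
    calc _ ≤ ENNReal.ofReal c * ENNReal.ofReal (c ^ n * h x) := by gcongr
      _ = _ := by rw [← ENNReal.ofReal_mul hc, pow_succ]; ring_nf

lemma exp_potential_step (hω : ∀ y, (ω y : ℝ) = 1 / 2 ∨ (ω y : ℝ) = 1) (m : ℕ) {t : ℝ}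
    (ht : 0 ≤ t) (y : ℤ) :
    ω y * Real.exp (t * potential {y | (ω y : ℝ) = 1} m (y + 1))
      + (1 - ω y) * Real.exp (t * potential {y | (ω y : ℝ) = 1} m (y - 1))
    ≤ Real.exp (t + t ^ 2 * (2 * m + 1) ^ 2 / 2)
      * Real.exp (t * potential {y | (ω y : ℝ) = 1} m y) := by
  set D : Set ℤ := {y | (ω y : ℝ) = 1} with hD
  rw [potential_add_one, potential_sub_one]
  by_cases hy : (ω y : ℝ) = 1
  · rw [hy, increment_of_mem m (show y ∈ D from hy), ← Real.exp_add, one_mul, sub_self, zero_mul,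
      add_zero]
    refine Real.exp_le_exp.2 ?_
    have : 0 ≤ t ^ 2 * (2 * (m : ℝ) + 1) ^ 2 / 2 := by positivity
    linarith
  · have hh : (ω y : ℝ) = 1 / 2 := (hω y).resolve_right hy
    have h := average_exp_le (S := 2 * m + 1) ht
      (zero_le_one.trans (one_le_increment D m y)) (zero_le_one.trans (one_le_increment D m (y - 1)))
      (increment_le D m y) (increment_le D m (y - 1)) (increment_sub_le m (show y ∉ D from hy))
    rw [hh, mul_add, mul_sub, sub_eq_add_neg (t * _), Real.exp_add, Real.exp_add]
    have hp := Real.exp_pos (t * potential D m y)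
    calc _ = (1 / 2 * Real.exp (t * increment D m y) + 1 / 2 * Real.exp (-(t * increment D m (y - 1))))
          * Real.exp (t * potential D m y) := by ring
      _ ≤ _ := mul_le_mul_of_nonneg_right h hp.le

/-- Almost surely the potential of the walk eventually grows at rate at most `1 + ε`. -/
lemma IsRandomWalkIn.eventually_potential_lt [IsProbabilityMeasure P]
    (hX : IsRandomWalkIn P ω x X) (hω : ∀ y, (ω y : ℝ) = 1 / 2 ∨ (ω y : ℝ) = 1) (m : ℕ) {ε : ℝ}
    (hε : 0 < ε) :
    ∀ᵐ w ∂P, ∀ᶠ N : ℕ in atTop, potential {y | (ω y : ℝ) = 1} m (X N w)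
      < potential {y | (ω y : ℝ) = 1} m x + (1 + ε) * N := by
  set F := potential {y | (ω y : ℝ) = 1} m with hF
  set S : ℝ := 2 * m + 1 with hS
  have hSpos : 0 < S := by positivity
  -- This minimises the Chernoff exponent t²S²/2 - tε, with value -ε²/(2S²).
  set t : ℝ := ε / S ^ 2 with ht
  have htpos : 0 < t := by positivity
  set r : ℝ := Real.exp (-(ε ^ 2 / (2 * S ^ 2))) with hr
  have hr1 : r < 1 := by
    rw [hr, Real.exp_lt_one_iff]
    have : 0 < ε ^ 2 / (2 * S ^ 2) := by positivity
    linarith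
  have hr0 : 0 ≤ r := (Real.exp_pos _).le
  have key : ∀ N : ℕ, P {w | F x + (1 + ε) * N ≤ F (X N w)} ≤ ENNReal.ofReal (r ^ N) := by
    intro N
    set L : ℝ := Real.exp (t * (F x + (1 + ε) * N)) with hL
    have hLpos : 0 < L := Real.exp_pos _
    have h1 := hX.lintegral_le (h := fun z => Real.exp (t * F z)) (fun z => (Real.exp_pos _).le)
      (Real.exp_pos _).le (exp_potential_step hω m htpos.le) N
    have hmeas : Measurable fun w => ENNReal.ofReal (Real.exp (t * F (X N w))) :=
      (Measurable.of_discrete (f := fun z : ℤ => ENNReal.ofReal (Real.exp (t * F z)))).comp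
        (hX.measurable N)
    have h2 := meas_ge_le_lintegral_div (μ := P) hmeas.aemeasurable
      (ε := ENNReal.ofReal L) (by simpa using hLpos) ENNReal.ofReal_ne_top
    have hsub : {w | F x + (1 + ε) * N ≤ F (X N w)}
        ⊆ {w | ENNReal.ofReal L ≤ ENNReal.ofReal (Real.exp (t * F (X N w)))} := by
      intro w hw
      exact ENNReal.ofReal_le_ofReal
        (Real.exp_le_exp.2 (mul_le_mul_of_nonneg_left hw htpos.le))
    refine (measure_mono hsub).trans (h2.trans ((ENNReal.div_le_div_right h1 _).trans ?_))
    rw [← ENNReal.ofReal_div_of_pos hLpos]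
    refine ENNReal.ofReal_le_ofReal (le_of_eq ?_)
    rw [hL, hr, ← Real.exp_nat_mul, ← Real.exp_nat_mul, ← Real.exp_add, ← Real.exp_sub]
    congr 1
    rw [ht]
    field_simp
    ring
  have hsum : ∑' N : ℕ, P {w | F x + (1 + ε) * N ≤ F (X N w)} ≠ ∞ := by
    refine ne_top_of_le_ne_top ?_ (ENNReal.tsum_le_tsum key)
    exact (summable_geometric_of_lt_one hr0 hr1).tsum_ofReal_ne_top
  filter_upwards [ae_eventually_notMem hsum] with w hw
  filter_upwards [hw] with N hN
  simpa using hN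

end Walk

/-! ### From drift density to a speed bound. -/

section Speed

/-- The average of the indicator stays in the unit interval, so its upper density bounds it
eventually. -/
lemma eventually_count_le {p lam : ℝ} {ω : ℤ → unitInterval} (hω : IsEnvironment p lam ω)
    {ε : ℝ} (hε : 0 < ε) :
    ∀ᶠ z : ℕ in atTop,
      ∑ y ∈ Finset.range z, Set.indicator {y : ℤ | (ω y : ℝ) = p} (fun _ => (1 : ℝ)) (y : ℤ)
        ≤ (lam + ε) * z := by
  have hb : IsBoundedUnder (· ≤ ·) atTop (fun n : ℕ =>
      (1 / ((n : ℝ) + 1)) * ∑ x ∈ Finset.range (n + 1),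
        Set.indicator {y : ℤ | (ω y : ℝ) = p} (fun _ => (1 : ℝ)) (x : ℤ)) := by
    refine isBoundedUnder_of ⟨1, fun n => ?_⟩
    have hs : ∑ x ∈ Finset.range (n + 1),
        Set.indicator {y : ℤ | (ω y : ℝ) = p} (fun _ => (1 : ℝ)) (x : ℤ)
        ≤ ∑ x ∈ Finset.range (n + 1), (1 : ℝ) :=
      Finset.sum_le_sum fun i _ => Set.indicator_le_self' (fun _ _ => zero_le_one) _
    have hn : (0 : ℝ) < n + 1 := by positivity
    rw [one_div, inv_mul_le_iff₀ hn]
    simpa using hs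
  have h := eventually_lt_of_limsup_lt (b := lam + ε) (by rw [hω.density]; linarith) hb
  obtain ⟨k, hk⟩ := eventually_atTop.1 h
  refine eventually_atTop.2 ⟨k + 1, fun z hz => ?_⟩
  obtain ⟨n, rfl⟩ : ∃ n, z = n + 1 := ⟨z - 1, by omega⟩
  have hn := hk n (by omega)
  have hpos : (0 : ℝ) < n + 1 := by positivity
  rw [one_div, inv_mul_lt_iff₀ hpos] at hn
  push_cast
  linarith

/-- The potential of an environment grows at least linearly to the right. -/
lemma exists_le_potential {lam : ℝ} {ω : ℤ → unitInterval} (hω : IsEnvironment 1 lam ω) (m : ℕ)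
    {ε : ℝ} (hε : 0 < ε) :
    ∃ C : ℝ, ∀ z : ℕ, (2 * m + 1 - m * (m + 1) * (lam + ε)) * (z : ℝ) - C
      ≤ potential {y | (ω y : ℝ) = 1} m z := by
  obtain ⟨z₀, hz₀⟩ := eventually_atTop.1 (eventually_count_le hω hε)
  -- The z₀ term covers the sites before the density bound takes effect.
  refine ⟨m ^ 2 + m * (m + 1) * z₀, fun z => ?_⟩
  have hle := le_potential {y : ℤ | (ω y : ℝ) = 1} m z
  have hc : ∑ y ∈ Finset.range z,
      Set.indicator {y : ℤ | (ω y : ℝ) = 1} (fun _ => (1 : ℝ)) (y : ℤ) ≤ (lam + ε) * z + z₀ := by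
    rcases le_total z₀ z with h | h
    · have := hz₀ z h
      have h0 : (0 : ℝ) ≤ z₀ := Nat.cast_nonneg _
      linarith
    · have hs : ∑ y ∈ Finset.range z,
          Set.indicator {y : ℤ | (ω y : ℝ) = 1} (fun _ => (1 : ℝ)) (y : ℤ)
          ≤ ∑ y ∈ Finset.range z, (1 : ℝ) :=
        Finset.sum_le_sum fun i _ => Set.indicator_le_self' (fun _ _ => zero_le_one) _
      have h1 : (z : ℝ) ≤ z₀ := by exact_mod_cast h
      have h2 : 0 ≤ (lam + ε) * z := mul_nonneg (by linarith [hω.lam_nonneg]) (Nat.cast_nonneg _)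
      simp only [Finset.sum_const, Finset.card_range, nsmul_eq_mul, mul_one] at hs
      linarith
  have hm : (0 : ℝ) ≤ m * (m + 1) := by positivity
  have := mul_le_mul_of_nonneg_left hc hm
  linarith

lemma limsup_div_le_of_eventually {u : ℕ → ℤ} {β : ℝ}
    (h : ∀ γ > β, ∃ C : ℝ, ∀ᶠ N : ℕ in atTop, (u N : ℝ) ≤ γ * N + C) :
    limsup (fun N : ℕ => (((u N : ℝ) / (N : ℝ) : ℝ) : EReal)) atTop ≤ (β : EReal) := by
  refine EReal.le_of_forall_lt_iff_le.1 fun γ hγ => ?_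
  have hγ' : β < γ := by exact_mod_cast hγ
  obtain ⟨δ, hδ1, hδ2⟩ := exists_between hγ'
  obtain ⟨C, hC⟩ := h δ hδ1
  refine limsup_le_of_le (by isBoundedDefault) ?_
  have hlim : ∀ᶠ N : ℕ in atTop, C ≤ (γ - δ) * N :=
    (tendsto_natCast_atTop_atTop.const_mul_atTop (sub_pos.2 hδ2)).eventually_ge_atTop C
  filter_upwards [hC, hlim, eventually_gt_atTop 0] with N h1 h2 h3
  have hN : (0 : ℝ) < N := by exact_mod_cast h3
  rw [EReal.coe_le_coe_iff, div_le_iff₀ hN]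
  linarith

lemma IsRandomWalkIn.limsup_le {Ω : Type*} [MeasurableSpace Ω] {P : Measure Ω}
    [IsProbabilityMeasure P] {ω : ℤ → unitInterval} {x : ℤ} {X : ℕ → Ω → ℤ}
    (hX : IsRandomWalkIn P ω x X) {lam : ℝ} (hω : IsEnvironment 1 lam ω) (m : ℕ)
    (hpos : 0 < 2 * m + 1 - m * (m + 1) * lam) :
    ∀ᵐ w ∂P, limsup (fun N : ℕ => (((X N w : ℝ) / (N : ℝ) : ℝ) : EReal)) atTop
      ≤ ((1 / (2 * m + 1 - m * (m + 1) * lam) : ℝ) : EReal) := by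
  set b : ℝ := 2 * m + 1 - m * (m + 1) * lam with hb
  -- Countably many ε keep the exceptional set null.
  have hall : ∀ᵐ w ∂P, ∀ k : ℕ, ∀ᶠ N : ℕ in atTop, potential {y | (ω y : ℝ) = 1} m (X N w)
      < potential {y | (ω y : ℝ) = 1} m x + (1 + 1 / ((k : ℝ) + 1)) * N :=
    ae_all_iff.2 fun k => hX.eventually_potential_lt hω.value m Nat.one_div_pos_of_nat
  filter_upwards [hall] with w hw
  refine limsup_div_le_of_eventually fun γ hγ => ?_
  have hγ0 : 0 < γ := lt_trans (by positivity) hγ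
  have hlim : Tendsto (fun k : ℕ => (b - m * (m + 1) * (1 / ((k : ℝ) + 1))) * γ
      - (1 + 1 / ((k : ℝ) + 1))) atTop (𝓝 ((b - m * (m + 1) * 0) * γ - (1 + 0))) :=
    (((tendsto_one_div_add_atTop_nhds_zero_nat.const_mul _).const_sub _).mul_const _).sub
      (tendsto_one_div_add_atTop_nhds_zero_nat.const_add _)
  have hlim0 : 0 < (b - m * (m + 1) * 0) * γ - (1 + 0) := by
    rw [gt_iff_lt, div_lt_iff₀ hpos] at hγ
    linarith
  obtain ⟨k, hk⟩ := (hlim.eventually (lt_mem_nhds hlim0)).exists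
  set ε : ℝ := 1 / ((k : ℝ) + 1) with hε
  have hεpos : 0 < ε := Nat.one_div_pos_of_nat
  have ha : 0 < b - m * (m + 1) * ε := by
    by_contra hcon
    have : (b - m * (m + 1) * ε) * γ ≤ 0 := mul_nonpos_of_nonpos_of_nonneg (not_lt.1 hcon) hγ0.le
    linarith
  set a : ℝ := b - m * (m + 1) * ε with hadef
  obtain ⟨C, hC⟩ := exists_le_potential hω m hεpos
  set F := potential {y | (ω y : ℝ) = 1} m with hF
  refine ⟨max 0 ((F x + C) / a), ?_⟩
  filter_upwards [hw k] with N hN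
  have hγN : 0 ≤ γ * N := by positivity
  -- The slope is controlled only to the right of 0; elsewhere the claim is trivial.
  rcases le_total (X N w) 0 with h | h
  · have : (X N w : ℝ) ≤ 0 := by exact_mod_cast h
    linarith [le_max_left 0 ((F x + C) / a)]
  · obtain ⟨z, hz⟩ := Int.eq_ofNat_of_zero_le h
    rw [hz] at hN ⊢
    have h1 := hC z
    have h2 : a * (z : ℝ) - C ≤ F z := by
      refine le_trans (le_of_eq ?_) h1
      rw [hadef, hb]; ring
    have h3 : (1 + ε) * (N : ℝ) ≤ a * γ * N :=
      mul_le_mul_of_nonneg_right (by linarith) (Nat.cast_nonneg _)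
    have h4 : (z : ℝ) ≤ γ * N + (F x + C) / a := by
      rw [← mul_le_mul_iff_right₀ ha, mul_add, mul_div_cancel₀ _ ha.ne']
      linarith
    push_cast
    linarith [le_max_right 0 ((F x + C) / a)]

/-- With s = m + θ and d = θ(1 - θ), the speed bound is s/(s² + d). -/
lemma one_div_speed_le {m θ c : ℝ} (hm : 1 ≤ m) (hθ : 0 < θ) (hc0 : 0 < c)
    (hc : c ≤ θ * (1 - θ)) (hc1 : c ≤ 1) :
    0 < 2 * m + 1 - m * (m + 1) * (1 / (m + θ)) ∧
    1 / (2 * m + 1 - m * (m + 1) * (1 / (m + θ)))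
      ≤ 1 / (m + θ) - c / 2 * (1 / (m + θ)) ^ 3 := by
  have hs : 0 < m + θ := by linarith
  have e : 2 * m + 1 - m * (m + 1) * (1 / (m + θ))
      = ((m + θ) ^ 2 + θ * (1 - θ)) / (m + θ) := by
    field_simp
    ring
  have hnum : 0 < (m + θ) ^ 2 + θ * (1 - θ) := by
    have := hc0.trans_le hc
    positivity
  rw [e]
  refine ⟨div_pos hnum hs, ?_⟩
  have e2 : 1 / (m + θ) - c / 2 * (1 / (m + θ)) ^ 3
      = ((m + θ) ^ 2 - c / 2) / (m + θ) ^ 3 := by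
    field_simp
  rw [e2, one_div_div, div_le_div_iff₀ hnum (pow_pos hs 3)]
  have hs1 : 1 ≤ (m + θ) ^ 2 := one_le_pow₀ (by linarith)
  generalize m + θ = s at *
  generalize θ * (1 - θ) = d at *
  -- This reduces to d = c, where the slack is c(s² - c)/2; halving c leaves this room.
  have : 0 ≤ (s ^ 2 - c / 2) * (d - c) := mul_nonneg (by linarith) (by linarith)
  nlinarith

end Speed

theorem proposition1p6 (n : ℕ) (hn : 1 < n) :
    ∃ D : ℝ, 0 < D ∧
      ∀ (m l : ℕ), 0 < m → 0 < l → l < n →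
      ∀ lam : ℝ, lam = (n : ℝ) / ((m : ℝ) * (n : ℝ) + (l : ℝ)) →
      ∀ ω : ℤ → unitInterval, IsEnvironment 1 lam ω →
      ∀ {Ω : Type*} [MeasurableSpace Ω] (P : Measure Ω) [IsProbabilityMeasure P]
        (x : ℤ) (X : ℕ → Ω → ℤ), IsRandomWalkIn P ω x X →
        ∀ᵐ w ∂P,
          limsup (fun N : ℕ => (((X N w : ℝ) / (N : ℝ) : ℝ) : EReal)) atTop
            ≤ ((lam - D * lam ^ 3 : ℝ) : EReal) := by
  have hn' : (1 : ℝ) < n := by exact_mod_cast hn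
  have hn0 : (0 : ℝ) < n := by linarith
  have hinv0 : 0 < 1 / (n : ℝ) := by positivity
  have hinv1 : 1 / (n : ℝ) < 1 := (div_lt_one hn0).2 hn'
  have hc0 : 0 < 1 / (n : ℝ) * (1 - 1 / n) := mul_pos hinv0 (by linarith)
  -- Here θ = l/n lies in [1/n, 1 - 1/n], where the concave θ(1 - θ) is smallest at the endpoints.
  refine ⟨1 / (n : ℝ) * (1 - 1 / n) / 2, by linarith, ?_⟩
  intro m l hm hl hln lam hlam ω hω Ω _ P _ x X hX
  have hm1 : (1 : ℝ) ≤ m := by exact_mod_cast hm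
  have hθ : 1 / (n : ℝ) ≤ (l : ℝ) / n := by
    gcongr
    exact_mod_cast hl
  have hθ' : (l : ℝ) / n ≤ 1 - 1 / n := by
    rw [div_le_iff₀ hn0, sub_mul, div_mul_cancel₀ _ hn0.ne', one_mul, le_sub_iff_add_le]
    exact_mod_cast hln
  have hl' : lam = 1 / (m + (l : ℝ) / n) := by
    rw [hlam]
    field_simp
  obtain ⟨h1, h2⟩ := one_div_speed_le (m := m) (θ := (l : ℝ) / n) hm1 (by linarith) hc0
    (by nlinarith) (by nlinarith)
  rw [← hl'] at h1 h2
  filter_upwards [hX.limsup_le hω m h1] with w hw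
  exact hw.trans (EReal.coe_le_coe_iff.2 h2)
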